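/- Let $\mathbf{k}$ be a field, let $X=\{x_1<\dots<x_n\}$ be a finite ordered set, and order the words of the free monoid $\langle X\rangle$ by the degree-lexicographic (deg-lex) order. For $f\neq 0$ in $\mathbf{k}\langle X\rangle$ let $\mathbf{LM}(f)$ be its leading monomial. A word is normal modulo a set $F\subseteq \mathbf{k}\langle X\rangle$ if it contains no $\mathbf{LM}(f)$, $0\ne f\in F$, as a subword (block of consecutive letters), and $F$ is reduced if each $f\in F$ is a linear combination of words normal modulo $F\setminus\{f\}$. For a two-sided ideal $I$, let $\mathcal{N}_m$ be the set of words of length $m$ that are normal modulo $I$, and let $\mathrm{Nor}(f)$ be the normal form of $f$, i.e. the unique linear combination of words normal modulo $I$ with $f-\mathrm{Nor}(f)\in I$. A Gröbner basis of $I$ is a set $G\subseteq I$ of monic polynomials which generates $I$ and such that the leading monomial of every nonzero $f\in I$ contains the leading monomial of some $g\in G$ as a subword. A quadratic algebra presented by quadratic relations that form a Gröbner basis for the deg-lex order on words in its (ordered) generators is called a PBW algebra, and these generators, in this order, are called PBW generators. Let $A=\mathbf{k}\langle X\rangle/I$, $I=(\Re)$, where $\Re$ is a reduced set of binomials $x y-a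 b$ with $x,y,a,b\in X$ and $xy>ab$; $A=\bigoplus_m A_m$ is graded by length. Let $d\ge 2$, let $A^{(d)}=\bigoplus_{m\ge 0}A_{md}$ be the $d$-Veronese subalgebra, graded by $(A^{(d)})_m=A_{md}$, and let $\mathcal{N}_d=\{v_1<v_2<\dots<v_p\}$ be enumerated in lexicographic order. Whenever $v_iv_j\notin\mathcal{N}_{2d}$, one has $\mathrm{Nor}(v_iv_j)=v_{i'}v_{j'}$ for a unique pair $(i',j')$; put $$\mathcal{R}^d=\{\,v_iv_j-v_{i'}v_{j'}\ \mid\ v_iv_j\notin\mathcal{N}_{2d},\ v_{i'}v_{j'}=\mathrm{Nor}(v_iv_j)\,\}\subseteq \mathbf{k}\langle v_1,\dots,v_p\rangle ,$$ where in $\mathbf{k}\langle v_1,\dots,v_p\rangle$ the $v_i$ are regarded as free generators. Then: (1) $A^{(d)}$ is a quadratic algebra with set of one-generators $\mathcal{N}_d$ and finite presentation $A^{(d)}=\mathbf{k}\langle v_1,\dots,v_p\rangle/(\mathcal{R}^d)$, as graded algebras, the generator $v_i$ corresponding to the class of the word $v_i$ in $A_d$. (2) $\mathcal{R}^d$ is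 linearly independent, and is a basis of the degree $2$ component $J_2$ of the two-sided ideal $J=(\mathcal{R}^d)$ of $\mathbf{k}\langle v_1,\dots,v_p\rangle$. (3) If $\Re$ is a Gröbner basis of $I$ with respect to the deg-lex order, then $A^{(d)}$ is a PBW algebra with PBW generators $v_1<\dots<v_p$; indeed $\mathcal{R}^d$ is a Gröbner basis of $J$ with respect to the deg-lex order on words in $v_1<\dots<v_p$. -/

import Mathlib

noncomputable section

namespace QuadVeronese

/-- The free unital associative algebra `𝕜⟨X⟩`, as the algebra of the free monoid `⟨X⟩`:
its elements are finite linear combinations of words. -/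
abbrev FreeAlg (𝕜 X : Type*) [Field 𝕜] : Type _ := MonoidAlgebra 𝕜 (FreeMonoid X)

/-- A word, viewed as a monomial of `𝕜⟨X⟩`. -/
def word (𝕜 : Type*) {X : Type*} [Field 𝕜] (w : FreeMonoid X) : FreeAlg 𝕜 X :=
  MonoidAlgebra.single w 1

/-- The (strict) lexicographic order on words. -/
def LexLT {X : Type*} [LinearOrder X] (u w : FreeMonoid X) : Prop :=
  List.Lex (· < ·) u.toList w.toList

/-- The (strict) degree-lexicographic order on words. -/
def DegLex {X : Type*} [LinearOrder X] (u w : FreeMonoid X) : Prop :=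
  u.length < w.length ∨ (u.length = w.length ∧ LexLT u w)

section Words

variable {𝕜 X : Type*} [Field 𝕜]

/-- `𝕜⟨X⟩_m = 𝕜 X^m`, the span of the words of length `m`. -/
def homogeneousPart (𝕜 X : Type*) [Field 𝕜] (m : ℕ) : Submodule 𝕜 (FreeAlg 𝕜 X) :=
  Submodule.span 𝕜 (word 𝕜 '' {w : FreeMonoid X | w.length = m})

variable [LinearOrder X]

/-- `u` is the leading monomial of `f` for the deg-lex order (in particular `f ≠ 0`). -/
def IsLeadingMonomial (f : FreeAlg 𝕜 X) (u : FreeMonoid X) : Prop :=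
  f.coeff u ≠ 0 ∧ ∀ w : FreeMonoid X, f.coeff w ≠ 0 → w ≠ u → DegLex w u

/-- The set `𝒩(F)` of words that are normal modulo `F`: the words having no leading monomial of
an element of `F` as a subword (i.e. as a block of consecutive letters). -/
def normalWords (F : Set (FreeAlg 𝕜 X)) : Set (FreeMonoid X) :=
  {w | ¬ ∃ f ∈ F, ∃ u, IsLeadingMonomial f u ∧ ∃ a b : FreeMonoid X, w = a * u * b}

/-- `𝒩(I)_m`, the words of length `m` that are normal modulo the ideal `I`. -/
def normalWordsOfLength (I : TwoSidedIdeal (FreeAlg 𝕜 X)) (m : ℕ) : Set (FreeMonoid X) :=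
  {w | w ∈ normalWords (I : Set (FreeAlg 𝕜 X)) ∧ w.length = m}

/-- `F` is reduced: each `f ∈ F` is a linear combination of words normal modulo `F \ {f}`. -/
def IsReducedSet (F : Set (FreeAlg 𝕜 X)) : Prop :=
  ∀ f ∈ F, ∀ w : FreeMonoid X, f.coeff w ≠ 0 → w ∈ normalWords (F \ {f})

/-- Every element of `F` is a quadratic binomial `x y - a b` with `x y > a b`. -/
def IsQuadraticBinomialSet (F : Set (FreeAlg 𝕜 X)) : Prop :=
  ∀ f ∈ F, ∃ x y a b : X,
    DegLex (FreeMonoid.of a * FreeMonoid.of b) (FreeMonoid.of x * FreeMonoid.of y) ∧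
    f = word 𝕜 (FreeMonoid.of x * FreeMonoid.of y) - word 𝕜 (FreeMonoid.of a * FreeMonoid.of b)

/-- `f₀` is the normal form `Nor(f)` of `f` modulo `I`: a linear combination of words normal
modulo `I` with `f - f₀ ∈ I`. -/
def IsNormalForm (I : TwoSidedIdeal (FreeAlg 𝕜 X)) (f f₀ : FreeAlg 𝕜 X) : Prop :=
  f₀ ∈ Submodule.span 𝕜 (word 𝕜 '' normalWords (I : Set (FreeAlg 𝕜 X))) ∧ f - f₀ ∈ I

/-- `G` is a Gröbner basis of the two-sided ideal `I` for the deg-lex order. -/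
structure IsGroebnerBasis (G : Set (FreeAlg 𝕜 X)) (I : TwoSidedIdeal (FreeAlg 𝕜 X)) : Prop where
  monic : ∀ g ∈ G, ∃ u, IsLeadingMonomial g u ∧ g.coeff u = 1
  generates : TwoSidedIdeal.span G = I
  divides : ∀ f ∈ I, ∀ u, IsLeadingMonomial f u →
    ∃ g ∈ G, ∃ u', IsLeadingMonomial g u' ∧ ∃ a b : FreeMonoid X, u = a * u' * b

end Words

section Algebras

variable {𝕜 X : Type*} [Field 𝕜]

/-- The algebra `𝕜⟨X⟩ / (R)`. -/
abbrev PresentedAlg (R : Set (FreeAlg 𝕜 X)) : Type _ :=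
  (TwoSidedIdeal.span R).ringCon.Quotient

/-- The quotient map `𝕜⟨X⟩ → 𝕜⟨X⟩ / (R)`. -/
def presentedMk (R : Set (FreeAlg 𝕜 X)) : FreeAlg 𝕜 X →ₐ[𝕜] PresentedAlg R :=
  (TwoSidedIdeal.span R).ringCon.mkₐ 𝕜

/-- The degree `m` part of `𝕜⟨X⟩ / (R)`, i.e. the image of `𝕜⟨X⟩_m`. -/
def gradedPart (R : Set (FreeAlg 𝕜 X)) (m : ℕ) : Submodule 𝕜 (PresentedAlg R) :=
  (homogeneousPart 𝕜 X m).map (presentedMk R).toLinearMap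

theorem word_mul (u w : FreeMonoid X) : word 𝕜 u * word 𝕜 w = word 𝕜 (u * w) := by
  simp [word]

theorem homogeneousPart_mul_le (m n : ℕ) :
    homogeneousPart 𝕜 X m * homogeneousPart 𝕜 X n ≤ homogeneousPart 𝕜 X (m + n) := by
  rw [homogeneousPart, homogeneousPart, Submodule.span_mul_span]
  refine Submodule.span_mono ?_
  rintro _ ⟨_, ⟨u, hu, rfl⟩, _, ⟨w, hw, rfl⟩, rfl⟩
  refine ⟨u * w, ?_, (word_mul u w).symm⟩
  simp only [Set.mem_ofPred_eq] at hu hw ⊢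
  rw [FreeMonoid.length_mul, hu, hw]

instance gradedPart_gradedMonoid (R : Set (FreeAlg 𝕜 X)) :
    SetLike.GradedMonoid (gradedPart R) where
  one_mem := ⟨1, Submodule.subset_span ⟨1, rfl, rfl⟩, map_one (presentedMk R)⟩
  mul_mem := by
    rintro i j _ _ ⟨a, ha, rfl⟩ ⟨b, hb, rfl⟩
    exact ⟨a * b, homogeneousPart_mul_le i j (Submodule.mul_mem_mul ha hb),
      map_mul (presentedMk R) a b⟩

/-- The `d`-Veronese subalgebra `A^{(d)} = ⨁ₘ A_{md}` of a graded algebra `A = ⨁ₘ Aₘ`. -/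
def veronese {A : Type*} [Ring A] [Algebra 𝕜 A] (𝒜 : ℕ → Submodule 𝕜 A)
    [SetLike.GradedMonoid 𝒜] (d : ℕ) : Subalgebra 𝕜 A :=
  (⨆ m : ℕ, 𝒜 (m * d)).toSubalgebra
    (Submodule.mem_iSup_of_mem 0 (by
      rw [Nat.zero_mul]
      exact SetLike.GradedOne.one_mem))
    (by
      intro x y hx hy
      have h : (⨆ m : ℕ, 𝒜 (m * d)) * (⨆ m : ℕ, 𝒜 (m * d)) ≤ ⨆ m : ℕ, 𝒜 (m * d) := by
        rw [Submodule.iSup_mul]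
        refine iSup_le fun i => ?_
        rw [Submodule.mul_iSup]
        refine iSup_le fun j => ?_
        refine le_trans ?_ (le_iSup (fun m : ℕ => 𝒜 (m * d)) (i + j))
        rw [Submodule.mul_le]
        intro a ha b hb
        rw [Nat.add_mul]
        exact SetLike.GradedMul.mul_mem ha hb
      exact h (Submodule.mul_mem_mul hx hy))

/-- The grading of the `d`-Veronese subalgebra: `(A^{(d)})_m = A_{md}`. -/
def veronesePart {A : Type*} [Ring A] [Algebra 𝕜 A] (𝒜 : ℕ → Submodule 𝕜 A)
    [SetLike.GradedMonoid 𝒜] (d m : ℕ) : Submodule 𝕜 (veronese 𝒜 d) :=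
  (𝒜 (m * d)).comap (veronese 𝒜 d).val.toLinearMap

/-- The algebra `B` with grading `ℬ` is a quadratic algebra with one-generators `g x`, `x ∈ Y`,
and finite set `R` of quadratic defining relations: `𝕜⟨Y⟩ / (R) ≅ B` as graded algebras through
`x ↦ g x`. -/
structure IsQuadraticPresentation {Y : Type*} {B : Type*} [Ring B] [Algebra 𝕜 B]
    (ℬ : ℕ → Submodule 𝕜 B) (g : Y → B) (R : Set (FreeAlg 𝕜 Y)) : Prop where
  finite_generators : Finite Y
  finite_relations : R.Finite
  quadratic : ∀ f ∈ R, f ∈ homogeneousPart 𝕜 Y 2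
  iso : ∃ φ : PresentedAlg R ≃ₐ[𝕜] B,
    (∀ y : Y, φ (presentedMk R (word 𝕜 (FreeMonoid.of y))) = g y) ∧
    ∀ m : ℕ, (gradedPart R m).map φ.toLinearMap = ℬ m

/-- The algebra `B` with grading `ℬ` is a PBW algebra with PBW-generators `g y`, enumerated in the
order of `Y`: it is a quadratic algebra presented by quadratic relations that form a Gröbner
basis for the deg-lex order. -/
def IsPBWGenerators {Y : Type*} [LinearOrder Y] {B : Type*} [Ring B] [Algebra 𝕜 B]
    (ℬ : ℕ → Submodule 𝕜 B) (g : Y → B) : Prop :=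
  ∃ R : Set (FreeAlg 𝕜 Y), IsQuadraticPresentation ℬ g R ∧
    IsGroebnerBasis R (TwoSidedIdeal.span R)

/-- The set of relations `v_i v_j - v_{i'} v_{j'}` with `v_i v_j` not normal and
`v_{i'} v_{j'} = Nor(v_i v_j)`, in the free algebra on `p` letters; the letter `i` stands
for `v_i`. -/
def veroneseRelations [LinearOrder X] (I : TwoSidedIdeal (FreeAlg 𝕜 X)) (d : ℕ) {p : ℕ}
    (v : Fin p → FreeMonoid X) : Set (FreeAlg 𝕜 (Fin p)) :=
  {f | ∃ i j i' j' : Fin p, v i * v j ∉ normalWordsOfLength I (2 * d) ∧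
    IsNormalForm I (word 𝕜 (v i * v j)) (word 𝕜 (v i' * v j')) ∧
    f = word 𝕜 (FreeMonoid.of i * FreeMonoid.of j) -
      word 𝕜 (FreeMonoid.of i' * FreeMonoid.of j')}

end Algebras

end QuadVeronese

end

/-!
Since the relations of `A` are differences of two words of equal length, `A` is the monoid algebra
of the quotient of `⟨X⟩` by a length-preserving congruence `∼`, and an element of `𝕜⟨X⟩` lies in `I`
exactly when its coefficients sum to zero over each congruence class (`mem_span_iff_classMap`).
The normal words are then the lexicographically smallest words of the classes
(`mem_normalWords_span_iff`), so the normal form of a word is a word, and every statement reduces to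
one about congruences of words.

Let `V` be the substitution `i ↦ v i` from words in the letters `i` to words in `X`
(`substWord`). Subwords of normal words are normal, so each word of length `m * d` is congruent to
`V s` for a unique word `s` of length `m` with `V s` normal; for `m = 2` this gives the Veronese
relations. The main point is that `s` and `t` are congruent modulo the Veronese relations as soon as
`V s ∼ V t` (`wordCon_veroneseRelations_iff`). To see this, cut any word whose length is a multiple
of `d` into blocks of length `d` and replace every block by the letter of its normal form. A
quadratic relation of `A` changes at most two consecutive blocks, and the two resulting pairs of
letters have congruent substitutions, hence reduce to the same normal pair by the Veronese
relations; thus the class of the word of letters does not change (`blockMap_congr`), and for `V s`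
this word is `s` itself. No Gröbner basis is needed for this. It follows that `V` induces an
isomorphism of `𝕜⟨v₁, …, v_p⟩` modulo the Veronese relations with the Veronese subalgebra.

The heads of the Veronese relations are distinct and non-normal while their tails are normal, which
gives linear independence; a quadratic element of the ideal equals, modulo the span of the
relations, its normal form, which is zero.

Finally, `V` is strictly increasing on words of equal length (`lexLT_substWord`), so the leading
monomial `s` of an element of `J` has `V s` non-normal. If `R` is a Gröbner basis, a non-normal word
contains a non-normal subword of length two, which lies inside two consecutive blocks; so `s`
contains the head of a Veronese relation (`exists_subword_not_normal`).
-/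

noncomputable section

namespace QuadVeronese

/-! ### The congruence on words defined by a two-sided ideal -/

section Congruence

variable {𝕜 Y : Type*} [Field 𝕜]

theorem coeff_word [DecidableEq (FreeMonoid Y)] (s t : FreeMonoid Y) :
    (word 𝕜 s).coeff t = if s = t then 1 else 0 := by
  classical
  simp [word, MonoidAlgebra.coeff_single, Finsupp.single_apply]

theorem eq_sum_smul_word (f : FreeAlg 𝕜 Y) :
    f = ∑ s ∈ f.coeff.support, f.coeff s • word 𝕜 s := by
  classical
  ext t
  simp only [MonoidAlgebra.coeff_sum, MonoidAlgebra.coeff_smul, Finsupp.finsetSum_apply,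
    Finsupp.smul_apply, coeff_word, smul_eq_mul, mul_ite, mul_one, mul_zero,
    Finset.sum_ite_eq', Finsupp.mem_support_iff]
  split_ifs with h
  · rfl
  · exact not_not.mp h

theorem mem_span_word_iff (S : Set (FreeMonoid Y)) (f : FreeAlg 𝕜 Y) :
    f ∈ Submodule.span 𝕜 (word 𝕜 '' S) ↔ ∀ w, f.coeff w ≠ 0 → w ∈ S := by
  classical
  constructor
  · intro hf
    induction hf using Submodule.span_induction with
    | mem x hx =>
      obtain ⟨s, hs, rfl⟩ := hx
      intro w hw
      rw [coeff_word] at hw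
      have : s = w := by by_contra h; simp [h] at hw
      exact this ▸ hs
    | zero => intro w hw; simp at hw
    | add x y _ _ hx hy =>
      intro w hw
      by_cases h : x.coeff w = 0
      · refine hy w fun h' => hw ?_
        simp [h, h']
      · exact hx w h
    | smul a x _ hx =>
      intro w hw
      refine hx w fun h => hw ?_
      simp [h]
  · intro h
    rw [eq_sum_smul_word f]
    refine Submodule.sum_mem _ fun s hs => Submodule.smul_mem _ _ (Submodule.subset_span ?_)
    exact ⟨s, h s (Finsupp.mem_support_iff.mp hs), rfl⟩

theorem word_mem_span_word_iff (S : Set (FreeMonoid Y)) (w : FreeMonoid Y) :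
    word 𝕜 w ∈ Submodule.span 𝕜 (word 𝕜 '' S) ↔ w ∈ S := by
  classical
  rw [mem_span_word_iff]
  refine ⟨fun h => h w (by simp [coeff_word]), fun h u hu => ?_⟩
  have : w = u := by by_contra h; simp [coeff_word, h] at hu
  exact this ▸ h

/-- The congruence on words induced by a two-sided ideal `I`: two words are congruent when they
have the same class modulo `I`. -/
def wordCon (I : TwoSidedIdeal (FreeAlg 𝕜 Y)) : Con (FreeMonoid Y) where
  r s t := word 𝕜 s - word 𝕜 t ∈ I
  iseqv :=
    { refl := fun s => by simp [I.zero_mem]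
      symm := fun h => by simpa using I.neg_mem h
      trans := fun h h' => by simpa using I.add_mem h h' }
  mul' := by
    intro s t s' t' h h'
    have key : word 𝕜 (s * s') - word 𝕜 (t * t') =
        (word 𝕜 s - word 𝕜 t) * word 𝕜 s' + word 𝕜 t * (word 𝕜 s' - word 𝕜 t') := by
      simp only [← word_mul]
      noncomm_ring
    change word 𝕜 (s * s') - word 𝕜 (t * t') ∈ I
    rw [key]
    exact I.add_mem (I.mul_mem_right _ _ h) (I.mul_mem_left _ _ h')

theorem wordCon_iff {I : TwoSidedIdeal (FreeAlg 𝕜 Y)} {s t : FreeMonoid Y} :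
    wordCon I s t ↔ word 𝕜 s - word 𝕜 t ∈ I := Iff.rfl

/-- The algebra map from `𝕜⟨Y⟩` to the monoid algebra of `⟨Y⟩` modulo a congruence. -/
def classMap (𝕜 : Type*) {Y : Type*} [Field 𝕜] (c : Con (FreeMonoid Y)) :
    FreeAlg 𝕜 Y →ₐ[𝕜] MonoidAlgebra 𝕜 c.Quotient :=
  MonoidAlgebra.mapDomainAlgHom 𝕜 𝕜 c.mk'

theorem classMap_word (c : Con (FreeMonoid Y)) (w : FreeMonoid Y) :
    classMap 𝕜 c (word 𝕜 w) = MonoidAlgebra.single (w : c.Quotient) 1 := by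
  simp [classMap, word]

theorem classMap_eq_zero_of_mem_span {R : Set (FreeAlg 𝕜 Y)} {c : Con (FreeMonoid Y)}
    (hR : ∀ f ∈ R, ∃ s t, f = word 𝕜 s - word 𝕜 t ∧ c s t) {f : FreeAlg 𝕜 Y}
    (hf : f ∈ TwoSidedIdeal.span R) : classMap 𝕜 c f = 0 := by
  rw [← TwoSidedIdeal.mem_ker]
  refine TwoSidedIdeal.span_le.mpr ?_ hf
  intro g hg
  obtain ⟨s, t, rfl, hst⟩ := hR g hg
  rw [SetLike.mem_coe, TwoSidedIdeal.mem_ker, map_sub, classMap_word, classMap_word,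
    (Con.eq c).mpr hst, sub_self]

/-- The congruence of the ideal generated by differences `s - t` of words is the smallest one that
relates all the pairs `s`, `t`: this is the induction principle for congruent words. -/
theorem wordCon_span_le {R : Set (FreeAlg 𝕜 Y)} {c : Con (FreeMonoid Y)}
    (hR : ∀ f ∈ R, ∃ s t, f = word 𝕜 s - word 𝕜 t ∧ c s t) :
    wordCon (TwoSidedIdeal.span R) ≤ c := by
  intro s t hst
  have h := classMap_eq_zero_of_mem_span hR hst
  rw [map_sub, classMap_word, classMap_word, sub_eq_zero] at h
  exact (Con.eq c).mp (MonoidAlgebra.single_left_injective one_ne_zero h)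

/-- Replacing each word `s` by `σ s` is a linear operation, so it changes `f` by a combination of
the differences `s - σ s`. -/
theorem sub_mapDomain_mem (W : Submodule 𝕜 (FreeAlg 𝕜 Y)) (σ : FreeMonoid Y → FreeMonoid Y)
    (f : FreeAlg 𝕜 Y) (h : ∀ s, f.coeff s ≠ 0 → word 𝕜 s - word 𝕜 (σ s) ∈ W) :
    f - f.mapDomain σ ∈ W := by
  have key : f - f.mapDomain σ =
      ∑ s ∈ f.coeff.support, f.coeff s • (word 𝕜 s - word 𝕜 (σ s)) := by
    simp only [smul_sub, Finset.sum_sub_distrib]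
    rw [← eq_sum_smul_word f]
    congr 1
    ext t
    simp [MonoidAlgebra.mapDomain, Finsupp.mapDomain, Finsupp.sum, word,
      MonoidAlgebra.coeff_sum, Finsupp.finsetSum_apply]
  rw [key]
  exact Submodule.sum_mem _ fun s hs =>
    Submodule.smul_mem _ _ (h s (Finsupp.mem_support_iff.mp hs))

/-- A two-sided ideal of `𝕜⟨Y⟩`, as a `𝕜`-subspace. -/
def idealSubmodule (I : TwoSidedIdeal (FreeAlg 𝕜 Y)) : Submodule 𝕜 (FreeAlg 𝕜 Y) :=
  (TwoSidedIdeal.asIdeal I).restrictScalars 𝕜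

theorem mem_idealSubmodule {I : TwoSidedIdeal (FreeAlg 𝕜 Y)} {f : FreeAlg 𝕜 Y} :
    f ∈ idealSubmodule I ↔ f ∈ I := by
  simp [idealSubmodule]

theorem span_le_idealSubmodule {Y : Type*} (F : Set (FreeAlg 𝕜 Y)) :
    Submodule.span 𝕜 F ≤ idealSubmodule (TwoSidedIdeal.span F) :=
  Submodule.span_le.mpr fun _ hf => mem_idealSubmodule.mpr (TwoSidedIdeal.subset_span hf)

/-- If a map `σ` on words is constant on congruence classes, then its linear extension factors
through `classMap`. -/
theorem mapDomain_eq_zero_of_classMap {c : Con (FreeMonoid Y)} {Z : Type*}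
    {σ : FreeMonoid Y → Z} (hσ : ∀ s t, c s t → σ s = σ t) {f : FreeAlg 𝕜 Y}
    (hf : classMap 𝕜 c f = 0) : f.mapDomain σ = 0 := by
  have h : f.mapDomain σ = (classMap 𝕜 c f).mapDomain (fun q => Con.liftOn q σ hσ) := by
    ext : 1
    simp only [classMap, MonoidAlgebra.mapDomainAlgHom_apply, MonoidAlgebra.mapDomain]
    rw [← Finsupp.mapDomain_comp]
    rfl
  rw [h, hf, MonoidAlgebra.mapDomain_zero]

/-- An element whose coefficients sum to zero over each congruence class of words lies in the
ideal. -/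
theorem mem_of_classMap_eq_zero {I : TwoSidedIdeal (FreeAlg 𝕜 Y)} {f : FreeAlg 𝕜 Y}
    (hf : classMap 𝕜 (wordCon I) f = 0) : f ∈ I := by
  let σ : FreeMonoid Y → FreeMonoid Y := fun s => Quotient.out (s : (wordCon I).Quotient)
  have h1 := sub_mapDomain_mem (idealSubmodule I) σ f fun s _ => by
    rw [mem_idealSubmodule]
    refine (wordCon I).symm ?_
    exact Quotient.mk_out (s := (wordCon I).toSetoid) s
  rwa [mapDomain_eq_zero_of_classMap (σ := σ) (fun s t hst => congrArg Quotient.out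
    ((Con.eq _).mpr hst)) hf, sub_zero, mem_idealSubmodule] at h1

/-- Since the coefficients of an element of the ideal sum to zero over each congruence class, a
word of its support is congruent to another word of its support. -/
theorem exists_ne_of_classMap_eq_zero {c : Con (FreeMonoid Y)} {f : FreeAlg 𝕜 Y}
    (hf : classMap 𝕜 c f = 0) {u : FreeMonoid Y} (hu : f.coeff u ≠ 0) :
    ∃ w, f.coeff w ≠ 0 ∧ w ≠ u ∧ c w u := by
  classical
  by_contra! H
  have h : (classMap 𝕜 c f).coeff (u : c.Quotient) = f.coeff u := by
    conv_lhs => rw [eq_sum_smul_word f]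
    simp only [map_sum, map_smul, classMap_word, MonoidAlgebra.coeff_sum,
      MonoidAlgebra.coeff_smul, MonoidAlgebra.coeff_single, Finsupp.finsetSum_apply,
      Finsupp.smul_apply, Finsupp.single_apply, smul_eq_mul]
    rw [Finset.sum_eq_single u]
    · simp
    · intro w hw hne
      rw [if_neg, mul_zero]
      exact fun h => H w (Finsupp.mem_support_iff.mp hw) hne ((Con.eq c).mp h)
    · intro h
      simp [Finsupp.notMem_support_iff.mp h]
  rw [hf] at h
  exact hu (by simpa using h.symm)

end Congruence

/-! ### Normal words modulo homogeneous binomials -/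

section Order

variable {X : Type*} [LinearOrder X]

theorem lexLT_iff {u w : FreeMonoid X} : LexLT u w ↔ u.toList < w.toList := Iff.rfl

theorem lexLT_irrefl (u : FreeMonoid X) : ¬ LexLT u u := by
  rw [lexLT_iff]; exact lt_irrefl _

theorem lexLT_or_eq_or_gt (u w : FreeMonoid X) : LexLT u w ∨ u = w ∨ LexLT w u := by
  simp only [lexLT_iff]
  rcases lt_trichotomy u.toList w.toList with h | h | h
  · exact Or.inl h
  · exact Or.inr (Or.inl (FreeMonoid.toList.injective h))
  · exact Or.inr (Or.inr h)

theorem LexLT.mul_left {u w : FreeMonoid X} (h : LexLT u w) (a : FreeMonoid X) :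
    LexLT (a * u) (a * w) :=
  List.Lex.append_left _ h _

theorem _root_.List.Lex.append_of_length_eq {u w : List X} (h : List.Lex (· < ·) u w)
    (hl : u.length = w.length) (a b : List X) : List.Lex (· < ·) (u ++ a) (w ++ b) := by
  induction h with
  | nil => simp at hl
  | cons h ih => exact List.Lex.cons (ih (by simpa using hl))
  | rel h => exact List.Lex.rel h

theorem LexLT.mul_right {u w : FreeMonoid X} (h : LexLT u w) (hl : u.length = w.length)
    (a b : FreeMonoid X) : LexLT (u * a) (w * b) :=
  List.Lex.append_of_length_eq h hl _ _

theorem isLeadingMonomial_word_sub_word (𝕜 : Type*) [Field 𝕜] {s t : FreeMonoid X}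
    (h : DegLex t s) (hne : t ≠ s) :
    IsLeadingMonomial (word 𝕜 s - word 𝕜 t) s ∧ (word 𝕜 s - word 𝕜 t).coeff s = 1 := by
  classical
  have h1 : (word 𝕜 s - word 𝕜 t).coeff s = 1 := by simp [coeff_word, hne]
  refine ⟨⟨by rw [h1]; exact one_ne_zero, fun w hw hws => ?_⟩, h1⟩
  have : t = w := by
    by_contra htw
    simp [coeff_word, htw, Ne.symm hws] at hw
  exact this ▸ h

end Order

section Normal

variable {𝕜 X : Type*} [Field 𝕜]

/-- `F` consists of differences of two words of the same length. -/
def IsHomogeneousBinomialSet (F : Set (FreeAlg 𝕜 X)) : Prop :=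
  ∀ f ∈ F, ∃ s t : FreeMonoid X, f = word 𝕜 s - word 𝕜 t ∧ s.length = t.length

theorem length_eq_of_wordCon {R : Set (FreeAlg 𝕜 X)} (hR : IsHomogeneousBinomialSet R)
    {u w : FreeMonoid X} (h : wordCon (TwoSidedIdeal.span R) u w) : u.length = w.length := by
  let c : Con (FreeMonoid X) :=
    { r := fun u w => u.length = w.length
      iseqv := ⟨fun _ => rfl, Eq.symm, Eq.trans⟩
      mul' := fun h h' => by
        rw [FreeMonoid.length_mul, FreeMonoid.length_mul]
        exact congrArg₂ (· + ·) h h' }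
  exact wordCon_span_le (c := c) hR h

theorem mem_span_iff_classMap {R : Set (FreeAlg 𝕜 X)} (hR : IsHomogeneousBinomialSet R)
    {f : FreeAlg 𝕜 X} :
    f ∈ TwoSidedIdeal.span R ↔ classMap 𝕜 (wordCon (TwoSidedIdeal.span R)) f = 0 := by
  refine ⟨classMap_eq_zero_of_mem_span fun g hg => ?_, mem_of_classMap_eq_zero⟩
  obtain ⟨s, t, h, -⟩ := hR g hg
  exact ⟨s, t, h, wordCon_iff.mpr (h ▸ TwoSidedIdeal.subset_span hg)⟩

theorem finite_length_eq [Finite X] (n : ℕ) : {w : FreeMonoid X | w.length = n}.Finite :=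
  List.finite_length_eq X n

variable [LinearOrder X]

theorem normalWords_of_mul {F : Set (FreeAlg 𝕜 X)} {a b : FreeMonoid X}
    (h : a * b ∈ normalWords F) : a ∈ normalWords F ∧ b ∈ normalWords F := by
  constructor
  · rintro ⟨f, hf, u, hu, x, y, rfl⟩
    exact h ⟨f, hf, u, hu, x, y * b, by simp only [mul_assoc]⟩
  · rintro ⟨f, hf, u, hu, x, y, rfl⟩
    exact h ⟨f, hf, u, hu, a * x, y, by simp only [mul_assoc]⟩

/-- The normal words modulo an ideal spanned by homogeneous binomials are the lexicographically
smallest words of their congruence classes. -/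
theorem mem_normalWords_span_iff {R : Set (FreeAlg 𝕜 X)} (hR : IsHomogeneousBinomialSet R)
    {w : FreeMonoid X} :
    w ∈ normalWords (TwoSidedIdeal.span R : Set (FreeAlg 𝕜 X)) ↔
      ∀ u, wordCon (TwoSidedIdeal.span R) u w → ¬ LexLT u w := by
  constructor
  · intro hw u hu hlt
    refine hw ⟨word 𝕜 w - word 𝕜 u, wordCon_iff.mp (Con.symm _ hu), w, ?_, 1, 1, by simp⟩
    refine (isLeadingMonomial_word_sub_word 𝕜 (Or.inr ⟨length_eq_of_wordCon hR hu, hlt⟩) ?_).1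
    rintro rfl
    exact lexLT_irrefl _ hlt
  · rintro H ⟨f, hf, u, hu, a, b, rfl⟩
    obtain ⟨t, ht, hne, htu⟩ :=
      exists_ne_of_classMap_eq_zero ((mem_span_iff_classMap hR).mp hf) hu.1
    have hl := length_eq_of_wordCon hR htu
    refine H (a * t * b) (Con.mul _ (Con.mul _ (Con.refl _ a) htu) (Con.refl _ b)) ?_
    rcases hu.2 t ht hne with h | ⟨-, h⟩
    · omega
    · exact (h.mul_left a).mul_right (by simp [FreeMonoid.length_mul, hl]) b b

theorem eq_of_normal {R : Set (FreeAlg 𝕜 X)} (hR : IsHomogeneousBinomialSet R)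
    {u w : FreeMonoid X} (hu : u ∈ normalWords (TwoSidedIdeal.span R : Set (FreeAlg 𝕜 X)))
    (hw : w ∈ normalWords (TwoSidedIdeal.span R : Set (FreeAlg 𝕜 X)))
    (h : wordCon (TwoSidedIdeal.span R) u w) : u = w := by
  rcases lexLT_or_eq_or_gt u w with h' | h' | h'
  · exact absurd h' ((mem_normalWords_span_iff hR).mp hw u h)
  · exact h'
  · exact absurd h' ((mem_normalWords_span_iff hR).mp hu w (Con.symm _ h))

theorem exists_normal_wordCon [Finite X] {R : Set (FreeAlg 𝕜 X)}
    (hR : IsHomogeneousBinomialSet R) (w : FreeMonoid X) :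
    ∃ u ∈ normalWords (TwoSidedIdeal.span R : Set (FreeAlg 𝕜 X)),
      wordCon (TwoSidedIdeal.span R) u w := by
  have hfin : {u | wordCon (TwoSidedIdeal.span R) u w}.Finite :=
    (finite_length_eq w.length).subset fun u hu => length_eq_of_wordCon hR hu
  obtain ⟨u, hu, hmin⟩ := Set.exists_min_image _ FreeMonoid.toList hfin
    ⟨w, Con.refl _ w⟩
  refine ⟨u, (mem_normalWords_span_iff hR).mpr fun t ht => ?_, hu⟩
  rw [lexLT_iff, not_lt]
  exact hmin t (Con.trans _ ht hu)

theorem isNormalForm_word_iff {I : TwoSidedIdeal (FreeAlg 𝕜 X)} {w u : FreeMonoid X} :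
    IsNormalForm I (word 𝕜 w) (word 𝕜 u) ↔
      u ∈ normalWords (I : Set (FreeAlg 𝕜 X)) ∧ wordCon I w u := by
  rw [IsNormalForm, word_mem_span_word_iff, wordCon_iff]

end Normal

/-! ### Words read in blocks of length `d` -/

section Blocks

variable {X : Type*}

theorem exists_mul_of_le_length {w : FreeMonoid X} {n : ℕ} (h : n ≤ w.length) :
    ∃ a b : FreeMonoid X, w = a * b ∧ a.length = n :=
  ⟨FreeMonoid.ofList (w.toList.take n), FreeMonoid.ofList (w.toList.drop n),
    (List.take_append_drop n w.toList).symm, List.length_take_of_le h⟩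

theorem mul_inj_of_length_eq {a b a' b' : FreeMonoid X} (h : a * b = a' * b')
    (hl : a.length = a'.length) : a = a' ∧ b = b' :=
  List.append_inj h hl

/-- Reading a word in blocks of length `d`: the product of the values of `β` at the first `m`
consecutive blocks of `w`. -/
def blockMap {M : Type*} [Monoid M] (d : ℕ) (β : FreeMonoid X → M) : ℕ → FreeMonoid X → M
  | 0, _ => 1
  | m + 1, w => β (FreeMonoid.ofList (w.toList.take d)) *
      blockMap d β m (FreeMonoid.ofList (w.toList.drop d))

variable {M : Type*} [Monoid M] {d : ℕ} {β : FreeMonoid X → M}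

theorem blockMap_succ_mul {u : FreeMonoid X} (hu : u.length = d) (m : ℕ) (w : FreeMonoid X) :
    blockMap d β (m + 1) (u * w) = β u * blockMap d β m w := by
  subst hu
  rw [blockMap]
  congr 2
  · exact List.take_left' rfl
  · exact List.drop_left' rfl

theorem blockMap_one {u : FreeMonoid X} (hu : u.length = d) : blockMap d β 1 u = β u := by
  have := blockMap_succ_mul (β := β) hu 0 1
  simpa [blockMap] using this

theorem blockMap_add_mul {m : ℕ} {u : FreeMonoid X} (hu : u.length = m * d) (k : ℕ)
    (w : FreeMonoid X) :
    blockMap d β (m + k) (u * w) = blockMap d β m u * blockMap d β k w := by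
  induction m generalizing u with
  | zero =>
    obtain rfl : u = 1 := FreeMonoid.length_eq_zero.mp (by simpa using hu)
    simp [blockMap]
  | succ m ih =>
    rw [Nat.succ_mul] at hu
    obtain ⟨a, b, rfl, ha⟩ := exists_mul_of_le_length (w := u) (n := d) (by omega)
    rw [FreeMonoid.length_mul] at hu
    rw [Nat.add_right_comm, mul_assoc, blockMap_succ_mul ha,
      blockMap_succ_mul ha, ih (by omega), mul_assoc]

end Blocks

/-! ### Normal forms of words in the Veronese generators -/

/-- The words `v i` enumerate, in lexicographic order, the normal words of length `d` modulo the
ideal generated by a set `R` of quadratic binomials. -/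
structure IsVeroneseEnumeration {𝕜 X : Type*} [Field 𝕜] [LinearOrder X] (R : Set (FreeAlg 𝕜 X))
    (d : ℕ) {p : ℕ} (v : Fin p → FreeMonoid X) : Prop where
  binomial : ∀ f ∈ R, ∃ s t : FreeMonoid X,
    f = word 𝕜 s - word 𝕜 t ∧ s.length = 2 ∧ t.length = 2
  pos : 0 < d
  lex : ∀ i j : Fin p, i < j → LexLT (v i) (v j)
  range : Set.range v = normalWordsOfLength (TwoSidedIdeal.span R) d

/-- The word in `X` obtained from a word in the letters `i` by substituting `v i`. -/
def substWord {X : Type*} {p : ℕ} (v : Fin p → FreeMonoid X) :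
    FreeMonoid (Fin p) →* FreeMonoid X :=
  FreeMonoid.lift v

/-- The letter `i` for which `v i` is the normal form of `w`; the junk value `1` is taken when no
`v i` is congruent to `w`. -/
def blockLetter {𝕜 X : Type*} [Field 𝕜] (R : Set (FreeAlg 𝕜 X)) {p : ℕ}
    (v : Fin p → FreeMonoid X) (w : FreeMonoid X) : FreeMonoid (Fin p) :=
  open Classical in
  if h : ∃ i, wordCon (TwoSidedIdeal.span R) (v i) w then FreeMonoid.of h.choose else 1

theorem substWord_of {X : Type*} {p : ℕ} (v : Fin p → FreeMonoid X) (i : Fin p) :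
    substWord v (FreeMonoid.of i) = v i := by
  simp [substWord]

theorem blockLetter_congr {𝕜 X : Type*} [Field 𝕜] {R : Set (FreeAlg 𝕜 X)} {p : ℕ}
    (v : Fin p → FreeMonoid X) {w w' : FreeMonoid X}
    (h : wordCon (TwoSidedIdeal.span R) w w') : blockLetter R v w = blockLetter R v w' := by
  have : (fun i => wordCon (TwoSidedIdeal.span R) (v i) w) =
      fun i => wordCon (TwoSidedIdeal.span R) (v i) w' :=
    funext fun i => propext ⟨fun h' => Con.trans _ h' h, fun h' => Con.trans _ h' (Con.symm _ h)⟩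
  have key : ∀ P Q : Fin p → Prop, P = Q →
      (open Classical in if h : ∃ i, P i then FreeMonoid.of h.choose else 1) =
        (open Classical in if h : ∃ i, Q i then FreeMonoid.of h.choose else 1) := by
    rintro P _ rfl
    rfl
  exact key _ _ this

namespace IsVeroneseEnumeration

variable {𝕜 X : Type*} [Field 𝕜] [LinearOrder X] {R : Set (FreeAlg 𝕜 X)}
  {d p : ℕ} {v : Fin p → FreeMonoid X}

theorem isHomogeneousBinomialSet (H : IsVeroneseEnumeration R d v) :
    IsHomogeneousBinomialSet R := fun f hf => by
  obtain ⟨s, t, h, hs, ht⟩ := H.binomial f hf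
  exact ⟨s, t, h, hs.trans ht.symm⟩

theorem normal (H : IsVeroneseEnumeration R d v) (i : Fin p) :
    v i ∈ normalWords (TwoSidedIdeal.span R : Set (FreeAlg 𝕜 X)) := by
  have : v i ∈ Set.range v := ⟨i, rfl⟩
  rw [H.range] at this
  exact this.1

theorem length (H : IsVeroneseEnumeration R d v) (i : Fin p) : (v i).length = d := by
  have : v i ∈ Set.range v := ⟨i, rfl⟩
  rw [H.range] at this
  exact this.2

theorem injective (H : IsVeroneseEnumeration R d v) : Function.Injective v := by
  intro i j h
  by_contra hne
  rcases lt_or_gt_of_ne hne with hlt | hlt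
  · exact lexLT_irrefl _ (h ▸ H.lex _ _ hlt)
  · exact lexLT_irrefl _ (h ▸ H.lex _ _ hlt)

theorem eq_of_wordCon (H : IsVeroneseEnumeration R d v) {i j : Fin p}
    (h : wordCon (TwoSidedIdeal.span R) (v i) (v j)) : i = j :=
  H.injective (eq_of_normal H.isHomogeneousBinomialSet (H.normal i) (H.normal j) h)

theorem length_substWord (H : IsVeroneseEnumeration R d v) (s : FreeMonoid (Fin p)) :
    (substWord v s).length = s.length * d := by
  induction s using FreeMonoid.inductionOn' with
  | one => simp
  | of_mul i s ih =>
    rw [map_mul, FreeMonoid.length_mul, FreeMonoid.length_mul, ih, substWord_of, H.length,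
      FreeMonoid.length_of, Nat.add_mul, Nat.one_mul]

/-- On words of equal length, substitution is strictly increasing for the lexicographic order,
because the words `v i` have equal lengths. -/
theorem lexLT_substWord (H : IsVeroneseEnumeration R d v) {s t : FreeMonoid (Fin p)}
    (h : LexLT s t) (hl : s.length = t.length) : LexLT (substWord v s) (substWord v t) := by
  have key : ∀ l l' : List (Fin p), List.Lex (· < ·) l l' → l.length = l'.length →
      LexLT (substWord v (FreeMonoid.ofList l)) (substWord v (FreeMonoid.ofList l')) := by
    intro l l' h
    induction h with
    | nil => intro hl; simp at hl
    | cons h ih =>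
      intro hl
      rw [FreeMonoid.ofList_cons, FreeMonoid.ofList_cons, map_mul, map_mul]
      exact (ih (by simpa using hl)).mul_left _
    | rel h =>
      intro _
      rw [FreeMonoid.ofList_cons, FreeMonoid.ofList_cons, map_mul, map_mul]
      refine LexLT.mul_right ?_ ?_ _ _
      · simpa only [substWord_of] using H.lex _ _ h
      · simp only [substWord_of, H.length]
  exact key s.toList t.toList h hl

theorem length_eq_of_wordCon_substWord (H : IsVeroneseEnumeration R d v)
    {s t : FreeMonoid (Fin p)}
    (h : wordCon (TwoSidedIdeal.span R) (substWord v s) (substWord v t)) :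
    s.length = t.length := by
  have h := length_eq_of_wordCon H.isHomogeneousBinomialSet h
  rw [H.length_substWord, H.length_substWord] at h
  exact Nat.eq_of_mul_eq_mul_right H.pos h

theorem substWord_injective (H : IsVeroneseEnumeration R d v) :
    Function.Injective (substWord v) := by
  intro s t h
  have hl : s.length = t.length := H.length_eq_of_wordCon_substWord (h ▸ Con.refl _ _)
  rcases lexLT_or_eq_or_gt s t with h' | h' | h'
  · exact absurd (h ▸ H.lexLT_substWord h' hl) (lexLT_irrefl _)
  · exact h'
  · exact absurd (h ▸ H.lexLT_substWord h' hl.symm) (lexLT_irrefl _)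

theorem exists_substWord_eq (H : IsVeroneseEnumeration R d v) {m : ℕ} {w : FreeMonoid X}
    (hw : w ∈ normalWords (TwoSidedIdeal.span R : Set (FreeAlg 𝕜 X)))
    (hl : w.length = m * d) : ∃ s : FreeMonoid (Fin p), s.length = m ∧ substWord v s = w := by
  induction m generalizing w with
  | zero => exact ⟨1, rfl, (FreeMonoid.length_eq_zero.mp (by simpa using hl)).symm⟩
  | succ m ih =>
    rw [Nat.succ_mul] at hl
    obtain ⟨a, b, rfl, ha⟩ := exists_mul_of_le_length (w := w) (n := d) (by omega)
    rw [FreeMonoid.length_mul] at hl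
    obtain ⟨s, hs, rfl⟩ := ih (normalWords_of_mul hw).2 (by omega)
    have : a ∈ Set.range v := by
      rw [H.range]
      exact ⟨(normalWords_of_mul hw).1, ha⟩
    obtain ⟨i, rfl⟩ := this
    exact ⟨FreeMonoid.of i * s, by rw [FreeMonoid.length_mul, hs, FreeMonoid.length_of]; omega,
      by rw [map_mul, substWord_of]⟩

section NormalForm

variable [Finite X]

theorem exists_normal_substWord (H : IsVeroneseEnumeration R d v) {m : ℕ} {w : FreeMonoid X}
    (hl : w.length = m * d) : ∃ s : FreeMonoid (Fin p), s.length = m ∧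
      substWord v s ∈ normalWords (TwoSidedIdeal.span R : Set (FreeAlg 𝕜 X)) ∧
      wordCon (TwoSidedIdeal.span R) (substWord v s) w := by
  obtain ⟨u, hu, huw⟩ := exists_normal_wordCon H.isHomogeneousBinomialSet w
  obtain ⟨s, hs, rfl⟩ := H.exists_substWord_eq (m := m) hu
    ((length_eq_of_wordCon H.isHomogeneousBinomialSet huw).trans hl)
  exact ⟨s, hs, hu, huw⟩

/-- The normal form of a word `s` in the letters `i`: the word whose substitution is the normal
form of the substitution of `s`. -/
def normalize (H : IsVeroneseEnumeration R d v) (s : FreeMonoid (Fin p)) : FreeMonoid (Fin p) :=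
  (H.exists_normal_substWord (H.length_substWord s)).choose

theorem length_normalize (H : IsVeroneseEnumeration R d v) (s : FreeMonoid (Fin p)) :
    (H.normalize s).length = s.length :=
  (H.exists_normal_substWord (H.length_substWord s)).choose_spec.1

theorem normal_normalize (H : IsVeroneseEnumeration R d v) (s : FreeMonoid (Fin p)) :
    substWord v (H.normalize s) ∈ normalWords (TwoSidedIdeal.span R : Set (FreeAlg 𝕜 X)) :=
  (H.exists_normal_substWord (H.length_substWord s)).choose_spec.2.1

theorem wordCon_normalize (H : IsVeroneseEnumeration R d v) (s : FreeMonoid (Fin p)) :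
    wordCon (TwoSidedIdeal.span R) (substWord v (H.normalize s)) (substWord v s) :=
  (H.exists_normal_substWord (H.length_substWord s)).choose_spec.2.2

theorem eq_normalize (H : IsVeroneseEnumeration R d v) {s t : FreeMonoid (Fin p)}
    (ht : substWord v t ∈ normalWords (TwoSidedIdeal.span R : Set (FreeAlg 𝕜 X)))
    (h : wordCon (TwoSidedIdeal.span R) (substWord v t) (substWord v s)) :
    t = H.normalize s :=
  H.substWord_injective (eq_of_normal H.isHomogeneousBinomialSet ht (H.normal_normalize s)
    (Con.trans _ h (Con.symm _ (H.wordCon_normalize s))))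

theorem normalize_congr (H : IsVeroneseEnumeration R d v) {s t : FreeMonoid (Fin p)}
    (h : wordCon (TwoSidedIdeal.span R) (substWord v s) (substWord v t)) :
    H.normalize s = H.normalize t :=
  H.eq_normalize (H.normal_normalize s) (Con.trans _ (H.wordCon_normalize s) h)

theorem mem_veroneseRelations_iff (H : IsVeroneseEnumeration R d v) {f : FreeAlg 𝕜 (Fin p)} :
    f ∈ veroneseRelations (TwoSidedIdeal.span R) d v ↔
      ∃ s : FreeMonoid (Fin p), s.length = 2 ∧
        substWord v s ∉ normalWords (TwoSidedIdeal.span R : Set (FreeAlg 𝕜 X)) ∧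
        f = word 𝕜 s - word 𝕜 (H.normalize s) := by
  have hlen : ∀ i j : Fin p, (v i * v j).length = 2 * d := fun i j => by
    rw [FreeMonoid.length_mul, H.length, H.length, Nat.two_mul]
  have hsub : ∀ i j : Fin p, substWord v (FreeMonoid.of i * FreeMonoid.of j) = v i * v j :=
    fun i j => by rw [map_mul, substWord_of, substWord_of]
  constructor
  · rintro ⟨i, j, i', j', hn, hnf, rfl⟩
    refine ⟨FreeMonoid.of i * FreeMonoid.of j, rfl, fun h => hn ⟨?_, hlen i j⟩, ?_⟩
    · rwa [hsub] at h
    · rw [isNormalForm_word_iff, ← hsub, ← hsub] at hnf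
      rw [H.eq_normalize hnf.1 (Con.symm _ hnf.2)]
  · rintro ⟨s, hs, hn, rfl⟩
    obtain ⟨i, j, rfl⟩ := FreeMonoid.length_eq_two.mp hs
    obtain ⟨i', j', h⟩ := FreeMonoid.length_eq_two.mp ((H.length_normalize _).trans hs)
    refine ⟨i, j, i', j', fun h' => hn (by rw [hsub]; exact h'.1), ?_, by rw [h]⟩
    rw [isNormalForm_word_iff, ← hsub, ← hsub, ← h]
    exact ⟨H.normal_normalize _, Con.symm _ (H.wordCon_normalize _)⟩

theorem isHomogeneousBinomialSet_veroneseRelations (H : IsVeroneseEnumeration R d v) :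
    IsHomogeneousBinomialSet (veroneseRelations (TwoSidedIdeal.span R) d v) := fun f hf => by
  obtain ⟨s, -, -, rfl⟩ := H.mem_veroneseRelations_iff.mp hf
  exact ⟨s, _, rfl, (H.length_normalize s).symm⟩

theorem sub_normalize_mem_span (H : IsVeroneseEnumeration R d v) {s : FreeMonoid (Fin p)}
    (hs : s.length = 2) : word 𝕜 s - word 𝕜 (H.normalize s) ∈
      Submodule.span 𝕜 (veroneseRelations (TwoSidedIdeal.span R) d v) := by
  by_cases hn : substWord v s ∈ normalWords (TwoSidedIdeal.span R : Set (FreeAlg 𝕜 X))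
  · rw [← H.eq_normalize hn (Con.refl _ _), sub_self]
    exact Submodule.zero_mem _
  · exact Submodule.subset_span (H.mem_veroneseRelations_iff.mpr ⟨s, hs, hn, rfl⟩)

theorem wordCon_veroneseRelations_of_length_two (H : IsVeroneseEnumeration R d v)
    {s t : FreeMonoid (Fin p)} (hs : s.length = 2)
    (h : wordCon (TwoSidedIdeal.span R) (substWord v s) (substWord v t)) :
    wordCon (TwoSidedIdeal.span (veroneseRelations (TwoSidedIdeal.span R) d v)) s t := by
  have ht : t.length = 2 := (H.length_eq_of_wordCon_substWord h).symm.trans hs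
  have h1 : ∀ u : FreeMonoid (Fin p), u.length = 2 →
      wordCon (TwoSidedIdeal.span (veroneseRelations (TwoSidedIdeal.span R) d v)) u
        (H.normalize u) := fun u hu =>
    wordCon_iff.mpr (mem_idealSubmodule.mp
      (span_le_idealSubmodule _ (H.sub_normalize_mem_span hu)))
  refine Con.trans _ (h1 s hs) ?_
  rw [H.normalize_congr h]
  exact Con.symm _ (h1 t ht)

/-! ### The congruence of the Veronese relations -/

theorem exists_blockLetter_eq (H : IsVeroneseEnumeration R d v) {w : FreeMonoid X}
    (hw : w.length = d) :
    ∃ i, blockLetter R v w = FreeMonoid.of i ∧ wordCon (TwoSidedIdeal.span R) (v i) w := by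
  have h : ∃ i, wordCon (TwoSidedIdeal.span R) (v i) w := by
    obtain ⟨s, hs, -, h⟩ := H.exists_normal_substWord (m := 1) (w := w) (by omega)
    obtain ⟨i, rfl⟩ := FreeMonoid.length_eq_one.mp hs
    exact ⟨i, by rwa [substWord_of] at h⟩
  exact ⟨h.choose, by rw [blockLetter, dif_pos h], h.choose_spec⟩

theorem blockMap_substWord (H : IsVeroneseEnumeration R d v) (s : FreeMonoid (Fin p)) :
    blockMap d (blockLetter R v) s.length (substWord v s) = s := by
  induction s using FreeMonoid.inductionOn' with
  | one => rfl
  | of_mul i s ih =>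
    obtain ⟨j, hj, hij⟩ := H.exists_blockLetter_eq (H.length i)
    rw [FreeMonoid.length_mul, FreeMonoid.length_of, Nat.add_comm, map_mul, substWord_of,
      blockMap_succ_mul (H.length i), ih, hj, H.eq_of_wordCon hij]

theorem blockMap_two_congr (H : IsVeroneseEnumeration R d v) {w w' : FreeMonoid X}
    (hw : w.length = 2 * d) (h : wordCon (TwoSidedIdeal.span R) w w') :
    wordCon (TwoSidedIdeal.span (veroneseRelations (TwoSidedIdeal.span R) d v))
      (blockMap d (blockLetter R v) 2 w) (blockMap d (blockLetter R v) 2 w') := by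
  have key : ∀ u : FreeMonoid X, u.length = 2 * d →
      (blockMap d (blockLetter R v) 2 u).length = 2 ∧
      wordCon (TwoSidedIdeal.span R) (substWord v (blockMap d (blockLetter R v) 2 u)) u := by
    intro u hu
    obtain ⟨a, b, rfl, ha⟩ := exists_mul_of_le_length (w := u) (n := d) (by omega)
    have hb : b.length = d := by rw [FreeMonoid.length_mul] at hu; omega
    obtain ⟨i, hi, hi'⟩ := H.exists_blockLetter_eq ha
    obtain ⟨j, hj, hj'⟩ := H.exists_blockLetter_eq hb
    rw [blockMap_succ_mul ha, blockMap_one hb, hi, hj, map_mul, substWord_of, substWord_of]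
    exact ⟨rfl, Con.mul _ hi' hj'⟩
  have hw' : w'.length = 2 * d :=
    (length_eq_of_wordCon H.isHomogeneousBinomialSet h).symm.trans hw
  exact H.wordCon_veroneseRelations_of_length_two (key w hw).1
    (Con.trans _ (key w hw).2 (Con.trans _ h (Con.symm _ (key w' hw').2)))

/-- One application of a defining relation of `A` inside a word of length `m * d` happens within
two consecutive blocks of length `d`, and therefore does not change the class modulo the Veronese
relations of the word of block normal forms. -/
theorem blockMap_congr_of_length_two (H : IsVeroneseEnumeration R d v) {w w' : FreeMonoid X}
    (hw : w.length = 2) (h : wordCon (TwoSidedIdeal.span R) w w') (m : ℕ) (a b : FreeMonoid X)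
    (hl : (a * w * b).length = m * d) :
    wordCon (TwoSidedIdeal.span (veroneseRelations (TwoSidedIdeal.span R) d v))
      (blockMap d (blockLetter R v) m (a * w * b))
      (blockMap d (blockLetter R v) m (a * w' * b)) := by
  have hpos := H.pos
  have hw' : w'.length = 2 := (length_eq_of_wordCon H.isHomogeneousBinomialSet h).symm.trans hw
  induction m generalizing a with
  | zero =>
    simp only [FreeMonoid.length_mul] at hl
    omega
  | succ m ih =>
    simp only [FreeMonoid.length_mul, Nat.succ_mul] at hl
    by_cases ha : d ≤ a.length
    · obtain ⟨a₁, a₂, rfl, ha₁⟩ := exists_mul_of_le_length ha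
      simp only [FreeMonoid.length_mul] at hl ih
      have := ih a₂ (by omega)
      simp only [mul_assoc, blockMap_succ_mul ha₁] at this ⊢
      exact Con.mul _ (Con.refl _ _) this
    · cases m with
      | zero =>
        rw [blockMap_one, blockMap_one, blockLetter_congr v]
        · exact Con.refl _ _
        · exact Con.mul _ (Con.mul _ (Con.refl _ _) h) (Con.refl _ _)
        · simp only [FreeMonoid.length_mul]; omega
        · simp only [FreeMonoid.length_mul]; omega
      | succ k =>
        rw [Nat.succ_mul] at hl
        obtain ⟨b₁, b₂, rfl, hb₁⟩ :=
          exists_mul_of_le_length (w := b) (n := 2 * d - 2 - a.length) (by omega)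
        have hab : ∀ u : FreeMonoid X, u.length = 2 → (a * u * b₁).length = 2 * d := fun u hu => by
          simp only [FreeMonoid.length_mul]; omega
        rw [← mul_assoc, ← mul_assoc, show k + 1 + 1 = 2 + k by omega,
          blockMap_add_mul (hab w hw), blockMap_add_mul (hab w' hw')]
        exact Con.mul _ (H.blockMap_two_congr (hab w hw)
          (Con.mul _ (Con.mul _ (Con.refl _ _) h) (Con.refl _ _))) (Con.refl _ _)

theorem blockMap_congr (H : IsVeroneseEnumeration R d v) {w w' : FreeMonoid X}
    (h : wordCon (TwoSidedIdeal.span R) w w') {m : ℕ} (hl : w.length = m * d) :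
    wordCon (TwoSidedIdeal.span (veroneseRelations (TwoSidedIdeal.span R) d v))
      (blockMap d (blockLetter R v) m w) (blockMap d (blockLetter R v) m w') := by
  -- The property is tested in all contexts `a * · * b`, which makes it a congruence.
  let c : Con (FreeMonoid X) :=
    { r := fun w w' => w.length = w'.length ∧ ∀ (m : ℕ) (a b : FreeMonoid X),
        (a * w * b).length = m * d →
        wordCon (TwoSidedIdeal.span (veroneseRelations (TwoSidedIdeal.span R) d v))
          (blockMap d (blockLetter R v) m (a * w * b))
          (blockMap d (blockLetter R v) m (a * w' * b))
      iseqv :=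
        { refl := fun w => ⟨rfl, fun m a b _ => Con.refl _ _⟩
          symm := fun {w w'} h => ⟨h.1.symm, fun m a b hl => Con.symm _ (h.2 m a b (by
            simpa only [FreeMonoid.length_mul, h.1] using hl))⟩
          trans := fun {w w' w''} h h' => ⟨h.1.trans h'.1, fun m a b hl =>
            Con.trans _ (h.2 m a b hl) (h'.2 m a b (by
              simpa only [FreeMonoid.length_mul, h.1] using hl))⟩ }
      mul' := by
        intro w w' u u' h h'
        refine ⟨by rw [FreeMonoid.length_mul, FreeMonoid.length_mul, h.1, h'.1],
          fun m a b hl => ?_⟩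
        have h1 := h.2 m a (u * b) (by simpa only [mul_assoc] using hl)
        have h2 := h'.2 m (a * w') b (by
          simpa only [FreeMonoid.length_mul, ← Nat.add_assoc, h.1] using hl)
        simp only [mul_assoc] at h1 h2 ⊢
        exact Con.trans _ h1 h2 }
  have hc : wordCon (TwoSidedIdeal.span R) ≤ c := by
    refine wordCon_span_le fun f hf => ?_
    obtain ⟨s, t, h, hs, ht⟩ := H.binomial f hf
    refine ⟨s, t, h, hs.trans ht.symm, fun m a b hl => ?_⟩
    exact H.blockMap_congr_of_length_two hs
      (wordCon_iff.mpr (h ▸ TwoSidedIdeal.subset_span hf)) m a b hl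
  simpa using (hc h).2 m 1 1 (by simpa using hl)

/-- Two words in the letters `i` are congruent modulo the Veronese relations iff their
substitutions are congruent modulo the relations of `A`. -/
theorem wordCon_veroneseRelations_iff (H : IsVeroneseEnumeration R d v)
    {s t : FreeMonoid (Fin p)} :
    wordCon (TwoSidedIdeal.span (veroneseRelations (TwoSidedIdeal.span R) d v)) s t ↔
      wordCon (TwoSidedIdeal.span R) (substWord v s) (substWord v t) := by
  constructor
  · intro h
    refine wordCon_span_le
      (c := Con.comap (substWord v) (map_mul _) (wordCon (TwoSidedIdeal.span R))) ?_ h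
    intro f hf
    obtain ⟨s, -, -, rfl⟩ := H.mem_veroneseRelations_iff.mp hf
    exact ⟨s, _, rfl, Con.symm _ (H.wordCon_normalize s)⟩
  · intro h
    have := H.blockMap_congr h (H.length_substWord s)
    rw [H.blockMap_substWord, H.length_eq_of_wordCon_substWord h, H.blockMap_substWord] at this
    exact this

end NormalForm

end IsVeroneseEnumeration

/-! ### Linear independence and the Gröbner basis property -/

namespace IsVeroneseEnumeration

variable {𝕜 X : Type*} [Field 𝕜] [LinearOrder X] {R : Set (FreeAlg 𝕜 X)}
  {d p : ℕ} {v : Fin p → FreeMonoid X}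

/-- If `R` is a Gröbner basis, normality is detected on subwords of length two; hence a word in the
letters `i` with non-normal substitution has a subword of length two with the same property. -/
theorem exists_subword_not_normal (H : IsVeroneseEnumeration R d v)
    (hG : IsGroebnerBasis R (TwoSidedIdeal.span R)) {s : FreeMonoid (Fin p)}
    (hs : substWord v s ∉ normalWords (TwoSidedIdeal.span R : Set (FreeAlg 𝕜 X))) :
    ∃ a t b : FreeMonoid (Fin p), s = a * t * b ∧ t.length = 2 ∧
      substWord v t ∉ normalWords (TwoSidedIdeal.span R : Set (FreeAlg 𝕜 X)) := by
  classical
  have hpos := H.pos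
  obtain ⟨f, hf, u, hu, x, y, hxy₀⟩ := not_not.mp hs
  obtain ⟨g, hg, u', hu', x', y', rfl⟩ := hG.divides f hf u hu
  have hl : u'.length = 2 := by
    obtain ⟨s, t, rfl, hs, ht⟩ := H.binomial g hg
    have h := hu'.1
    by_contra hne
    refine h ?_
    have h1 : s ≠ u' := by rintro rfl; exact hne hs
    have h2 : t ≠ u' := by rintro rfl; exact hne ht
    simp [coeff_word, h1, h2]
  have hn : ∀ a b : FreeMonoid X,
      a * u' * b ∉ normalWords (TwoSidedIdeal.span R : Set (FreeAlg 𝕜 X)) := fun a b h =>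
    h ⟨g, TwoSidedIdeal.subset_span hg, u', hu', a, b, rfl⟩
  have hxy : substWord v s = (x * x') * u' * (y' * y) := by rw [hxy₀]; simp only [mul_assoc]
  generalize x * x' = a at hxy
  generalize y' * y = b at hxy
  clear hs hxy₀
  induction s using FreeMonoid.inductionOn' generalizing a with
  | one =>
    have := congrArg FreeMonoid.length hxy
    simp only [map_one, FreeMonoid.length_one, FreeMonoid.length_mul] at this
    omega
  | of_mul i s ih =>
    by_cases ha : d ≤ a.length
    · obtain ⟨a₁, a₂, rfl, ha₁⟩ := exists_mul_of_le_length ha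
      rw [map_mul, substWord_of, mul_assoc, mul_assoc] at hxy
      obtain ⟨-, h⟩ := mul_inj_of_length_eq hxy ((H.length i).trans ha₁.symm)
      obtain ⟨a', t, b', rfl, ht⟩ := ih a₂ (by rw [h, mul_assoc])
      exact ⟨FreeMonoid.of i * a', t, b', by simp only [mul_assoc], ht⟩
    · -- `u'` starts inside the first block, so it ends inside the first two.
      cases s using FreeMonoid.casesOn with
      | one =>
        exfalso
        rw [mul_one, substWord_of] at hxy
        exact hn a b (hxy ▸ H.normal i)
      | of_mul j s =>
        refine ⟨1, FreeMonoid.of i * FreeMonoid.of j, s, by simp only [mul_assoc, one_mul], rfl, ?_⟩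
        have hlen := congrArg FreeMonoid.length hxy
        rw [H.length_substWord] at hlen
        simp only [FreeMonoid.length_mul, FreeMonoid.length_of, Nat.add_mul] at hlen
        obtain ⟨b₁, b₂, rfl, hb₁⟩ :=
          exists_mul_of_le_length (w := b) (n := 2 * d - 2 - a.length) (by omega)
        rw [← mul_assoc, ← mul_assoc, map_mul] at hxy
        obtain ⟨h, -⟩ := mul_inj_of_length_eq hxy (by
          rw [H.length_substWord]
          simp only [FreeMonoid.length_mul, FreeMonoid.length_of]
          omega)
        rw [h]
        exact hn a b₁

variable [Finite X]

theorem existsUnique_isNormalForm (H : IsVeroneseEnumeration R d v) (i j : Fin p) :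
    ∃! q : Fin p × Fin p, IsNormalForm (TwoSidedIdeal.span R)
      (word 𝕜 (v i * v j)) (word 𝕜 (v q.1 * v q.2)) := by
  have hsub : ∀ i j : Fin p, v i * v j = substWord v (FreeMonoid.of i * FreeMonoid.of j) :=
    fun i j => by rw [map_mul, substWord_of, substWord_of]
  simp only [hsub, isNormalForm_word_iff]
  obtain ⟨i', j', h⟩ := FreeMonoid.length_eq_two.mp
    (H.length_normalize (FreeMonoid.of i * FreeMonoid.of j))
  refine ⟨(i', j'), ?_, ?_⟩
  · simp only [← h]
    exact ⟨H.normal_normalize _, Con.symm _ (H.wordCon_normalize _)⟩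
  · rintro ⟨k, l⟩ ⟨hn, hc⟩
    have h' := (H.eq_normalize hn (Con.symm _ hc)).trans h
    obtain ⟨h1, h2⟩ := mul_inj_of_length_eq h' rfl
    exact Prod.ext (FreeMonoid.of_injective h1) (FreeMonoid.of_injective h2)

theorem linearIndepOn_veroneseRelations (H : IsVeroneseEnumeration R d v) :
    LinearIndepOn 𝕜 id (veroneseRelations (TwoSidedIdeal.span R) d v) := by
  classical
  choose! s hs2 hsn hsf using fun (f : FreeAlg 𝕜 (Fin p)) hf => H.mem_veroneseRelations_iff.mp hf
  -- The dual functionals read the coefficient of the head of each relation, which occurs in no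
  -- other relation because all tails are normal.
  have hne : ∀ (u t : FreeMonoid (Fin p)),
      substWord v u ∉ normalWords (TwoSidedIdeal.span R : Set (FreeAlg 𝕜 X)) →
      H.normalize t ≠ u := fun u t hu h => hu (h ▸ H.normal_normalize t)
  let φ : veroneseRelations (TwoSidedIdeal.span R) d v → Module.Dual 𝕜 (FreeAlg 𝕜 (Fin p)) :=
    fun f =>
      { toFun := fun g => g.coeff (s f)
        map_add' := fun g g' => by simp
        map_smul' := fun a g => by simp }
  refine LinearIndependent.of_pairwise_dual_eq_zero_one _ φ ?_ ?_
  · rintro ⟨f, hf⟩ ⟨g, hg⟩ hfg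
    change g.coeff (s f) = 0
    have : s g ≠ s f := fun h => hfg (Subtype.ext ((hsf f hf).trans (h ▸ (hsf g hg).symm)))
    rw [hsf g hg]
    simp [coeff_word, this, hne _ (s g) (hsn f hf)]
  · rintro ⟨f, hf⟩
    change f.coeff (s f) = 1
    rw [congrArg (fun g => g.coeff (s f)) (hsf f hf)]
    simp [coeff_word, hne _ (s f) (hsn f hf)]

theorem mem_span_veroneseRelations_iff (H : IsVeroneseEnumeration R d v)
    (f : FreeAlg 𝕜 (Fin p)) :
    f ∈ Submodule.span 𝕜 (veroneseRelations (TwoSidedIdeal.span R) d v) ↔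
      f ∈ TwoSidedIdeal.span (veroneseRelations (TwoSidedIdeal.span R) d v) ∧
      f ∈ homogeneousPart 𝕜 (Fin p) 2 := by
  constructor
  · intro hf
    refine ⟨mem_idealSubmodule.mp (span_le_idealSubmodule _ hf), ?_⟩
    refine Submodule.span_le.mpr ?_ hf
    intro g hg
    obtain ⟨s, hs, -, rfl⟩ := H.mem_veroneseRelations_iff.mp hg
    exact Submodule.sub_mem _ (Submodule.subset_span ⟨s, hs, rfl⟩)
      (Submodule.subset_span ⟨_, (H.length_normalize s).trans hs, rfl⟩)
  · rintro ⟨hJ, h2⟩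
    have h := sub_mapDomain_mem _ H.normalize f fun s hs =>
      H.sub_normalize_mem_span ((mem_span_word_iff _ f).mp h2 s hs)
    rwa [mapDomain_eq_zero_of_classMap
      (fun s t hst => H.normalize_congr (H.wordCon_veroneseRelations_iff.mp hst))
      ((mem_span_iff_classMap H.isHomogeneousBinomialSet_veroneseRelations).mp hJ),
      sub_zero] at h

theorem isLeadingMonomial_relation (H : IsVeroneseEnumeration R d v) {s : FreeMonoid (Fin p)}
    (hn : substWord v s ∉ normalWords (TwoSidedIdeal.span R : Set (FreeAlg 𝕜 X))) :
    IsLeadingMonomial (word 𝕜 s - word 𝕜 (H.normalize s)) s ∧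
      (word 𝕜 s - word 𝕜 (H.normalize s)).coeff s = 1 := by
  have hne : H.normalize s ≠ s := fun h => hn (h ▸ H.normal_normalize s)
  refine isLeadingMonomial_word_sub_word 𝕜 (Or.inr ⟨H.length_normalize s, ?_⟩) hne
  rcases lexLT_or_eq_or_gt (H.normalize s) s with h | h | h
  · exact h
  · exact absurd h hne
  · exact absurd (H.lexLT_substWord h (H.length_normalize s).symm)
      ((mem_normalWords_span_iff H.isHomogeneousBinomialSet).mp (H.normal_normalize s) _
        (Con.symm _ (H.wordCon_normalize s)))

theorem isGroebnerBasis_veroneseRelations (H : IsVeroneseEnumeration R d v)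
    (hG : IsGroebnerBasis R (TwoSidedIdeal.span R)) :
    IsGroebnerBasis (veroneseRelations (TwoSidedIdeal.span R) d v)
      (TwoSidedIdeal.span (veroneseRelations (TwoSidedIdeal.span R) d v)) where
  monic f hf := by
    obtain ⟨s, -, hn, rfl⟩ := H.mem_veroneseRelations_iff.mp hf
    exact ⟨s, H.isLeadingMonomial_relation hn⟩
  generates := rfl
  divides f hf s hs := by
    obtain ⟨t, ht, hne, hts⟩ := exists_ne_of_classMap_eq_zero
      ((mem_span_iff_classMap H.isHomogeneousBinomialSet_veroneseRelations).mp hf) hs.1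
    rw [H.wordCon_veroneseRelations_iff] at hts
    have hl := H.length_eq_of_wordCon_substWord hts
    have hlt : LexLT t s := by
      rcases hs.2 t ht hne with h | ⟨-, h⟩
      · omega
      · exact h
    have hn : substWord v s ∉ normalWords (TwoSidedIdeal.span R : Set (FreeAlg 𝕜 X)) := fun h =>
      (mem_normalWords_span_iff H.isHomogeneousBinomialSet).mp h _ hts (H.lexLT_substWord hlt hl)
    obtain ⟨a, u, b, rfl, hu, hun⟩ := H.exists_subword_not_normal hG hn
    exact ⟨_, H.mem_veroneseRelations_iff.mpr ⟨u, hu, hun, rfl⟩, u,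
      (H.isLeadingMonomial_relation hun).1, a, b, rfl⟩

end IsVeroneseEnumeration

/-! ### The presentation of the Veronese subalgebra -/

section Presentation

variable {𝕜 X : Type*} [Field 𝕜]

theorem presentedMk_eq_zero_iff {Y : Type*} {F : Set (FreeAlg 𝕜 Y)} {f : FreeAlg 𝕜 Y} :
    presentedMk F f = 0 ↔ f ∈ TwoSidedIdeal.span F :=
  (RingCon.eq (TwoSidedIdeal.span F).ringCon).trans Iff.rfl

/-- The algebra map from the free algebra on the letters `i` to `A` which sends `i` to the class
of the word `v i`. -/
def substHom (R : Set (FreeAlg 𝕜 X)) {p : ℕ} (v : Fin p → FreeMonoid X) :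
    FreeAlg 𝕜 (Fin p) →ₐ[𝕜] PresentedAlg R :=
  (presentedMk R).comp (MonoidAlgebra.mapDomainAlgHom 𝕜 𝕜 (substWord v))

theorem substHom_word (R : Set (FreeAlg 𝕜 X)) {p : ℕ} (v : Fin p → FreeMonoid X)
    (s : FreeMonoid (Fin p)) :
    substHom R v (word 𝕜 s) = presentedMk R (word 𝕜 (substWord v s)) := by
  simp [substHom, word]

namespace IsVeroneseEnumeration

variable [LinearOrder X] {R : Set (FreeAlg 𝕜 X)} {d p : ℕ} {v : Fin p → FreeMonoid X} [Finite X]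

theorem substHom_eq_zero_iff (H : IsVeroneseEnumeration R d v) {f : FreeAlg 𝕜 (Fin p)} :
    substHom R v f = 0 ↔
      f ∈ TwoSidedIdeal.span (veroneseRelations (TwoSidedIdeal.span R) d v) := by
  -- Substitution induces an injective map on congruence classes.
  let ι : (wordCon (TwoSidedIdeal.span (veroneseRelations (TwoSidedIdeal.span R) d v))).Quotient →
      (wordCon (TwoSidedIdeal.span R)).Quotient :=
    fun q => Con.liftOn q (fun s => ((substWord v s : FreeMonoid X) : (wordCon _).Quotient))
      fun s t h => (Con.eq _).mpr (H.wordCon_veroneseRelations_iff.mp h)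
  have hι : Function.Injective ι := by
    intro q q'
    induction q using Con.induction_on
    induction q' using Con.induction_on
    exact fun h => (Con.eq _).mpr (H.wordCon_veroneseRelations_iff.mpr ((Con.eq _).mp h))
  have key : classMap 𝕜 (wordCon (TwoSidedIdeal.span R))
      (MonoidAlgebra.mapDomainAlgHom 𝕜 𝕜 (substWord v) f) =
      (classMap 𝕜 (wordCon (TwoSidedIdeal.span (veroneseRelations (TwoSidedIdeal.span R) d v)))
        f).mapDomain ι := by
    ext : 1
    simp only [classMap, MonoidAlgebra.mapDomainAlgHom_apply, MonoidAlgebra.mapDomain]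
    rw [← Finsupp.mapDomain_comp, ← Finsupp.mapDomain_comp]
    rfl
  rw [substHom, AlgHom.comp_apply, presentedMk_eq_zero_iff,
    mem_span_iff_classMap H.isHomogeneousBinomialSet, key,
    mem_span_iff_classMap H.isHomogeneousBinomialSet_veroneseRelations]
  constructor
  · intro h
    exact MonoidAlgebra.mapDomain_injective hι (h.trans (MonoidAlgebra.mapDomain_zero ι).symm)
  · intro h
    rw [h, MonoidAlgebra.mapDomain_zero]

theorem map_substHom_homogeneousPart (H : IsVeroneseEnumeration R d v) (m : ℕ) :
    (homogeneousPart 𝕜 (Fin p) m).map (substHom R v).toLinearMap = gradedPart R (m * d) := by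
  rw [gradedPart, homogeneousPart, homogeneousPart, Submodule.map_span, Submodule.map_span]
  apply le_antisymm
  · refine Submodule.span_mono ?_
    rintro _ ⟨_, ⟨s, hs, rfl⟩, rfl⟩
    refine ⟨word 𝕜 (substWord v s), ⟨_, ?_, rfl⟩, (substHom_word R v s).symm⟩
    exact (H.length_substWord s).trans (congrArg (· * d) hs)
  · refine Submodule.span_mono ?_
    rintro _ ⟨_, ⟨w, hw, rfl⟩, rfl⟩
    obtain ⟨s, hs, -, hsw⟩ := H.exists_normal_substWord hw
    refine ⟨word 𝕜 s, ⟨s, hs, rfl⟩, (substHom_word R v s).trans ?_⟩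
    rw [AlgHom.toLinearMap_apply, ← sub_eq_zero, ← map_sub, presentedMk_eq_zero_iff]
    exact wordCon_iff.mp hsw

theorem substHom_mem_veronese (H : IsVeroneseEnumeration R d v) (f : FreeAlg 𝕜 (Fin p)) :
    substHom R v f ∈ veronese (gradedPart R) d := by
  rw [eq_sum_smul_word f, map_sum]
  refine Subalgebra.sum_mem _ fun s _ => ?_
  rw [map_smul]
  refine Subalgebra.smul_mem _ ?_ _
  refine Submodule.mem_iSup_of_mem s.length ?_
  rw [← H.map_substHom_homogeneousPart]
  exact ⟨word 𝕜 s, Submodule.subset_span ⟨s, rfl, rfl⟩, rfl⟩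

/-- The map `substHom` with values in the Veronese subalgebra. -/
def veroneseHom (H : IsVeroneseEnumeration R d v) :
    FreeAlg 𝕜 (Fin p) →ₐ[𝕜] veronese (gradedPart R) d :=
  (substHom R v).codRestrict _ H.substHom_mem_veronese

theorem veroneseHom_surjective (H : IsVeroneseEnumeration R d v) :
    Function.Surjective H.veroneseHom := by
  rintro ⟨y, hy⟩
  have h : (⨆ m : ℕ, gradedPart R (m * d)) ≤ LinearMap.range (substHom R v).toLinearMap := by
    refine iSup_le fun m => ?_
    rw [← H.map_substHom_homogeneousPart]
    exact LinearMap.map_le_range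
  obtain ⟨f, hf⟩ := h hy
  exact ⟨f, Subtype.ext hf⟩

theorem ringCon_eq_ker_veroneseHom (H : IsVeroneseEnumeration R d v) :
    (TwoSidedIdeal.span (veroneseRelations (TwoSidedIdeal.span R) d v)).ringCon =
      RingCon.ker H.veroneseHom.toRingHom := by
  refine RingCon.ext fun f g => ?_
  rw [TwoSidedIdeal.rel_iff, ← H.substHom_eq_zero_iff, map_sub, sub_eq_zero]
  exact (Subtype.ext_iff (a1 := H.veroneseHom f) (a2 := H.veroneseHom g)).symm

/-- The isomorphism of `𝕜⟨v₁, …, v_p⟩` modulo the Veronese relations with the Veronese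
subalgebra. -/
def veroneseEquiv (H : IsVeroneseEnumeration R d v) :
    PresentedAlg (veroneseRelations (TwoSidedIdeal.span R) d v) ≃ₐ[𝕜] veronese (gradedPart R) d :=
  AlgEquiv.ofBijective (RingCon.liftₐ _ H.veroneseHom H.ringCon_eq_ker_veroneseHom.le) (by
    rw [RingCon.coe_liftₐ]
    exact RingCon.lift_bijective_iff.mpr ⟨H.ringCon_eq_ker_veroneseHom, H.veroneseHom_surjective⟩)

theorem veroneseEquiv_presentedMk (H : IsVeroneseEnumeration R d v) (f : FreeAlg 𝕜 (Fin p)) :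
    H.veroneseEquiv (presentedMk _ f) = H.veroneseHom f := rfl

theorem finite_veroneseRelations (H : IsVeroneseEnumeration R d v) :
    (veroneseRelations (TwoSidedIdeal.span R) d v).Finite := by
  refine ((finite_length_eq (X := Fin p) 2).image
    fun s => word 𝕜 s - word 𝕜 (H.normalize s)).subset fun f hf => ?_
  obtain ⟨s, hs, -, rfl⟩ := H.mem_veroneseRelations_iff.mp hf
  exact ⟨s, hs, rfl⟩

theorem isQuadraticPresentation (H : IsVeroneseEnumeration R d v) :
    IsQuadraticPresentation (veronesePart (gradedPart R) d)
      (fun i => H.veroneseHom (word 𝕜 (FreeMonoid.of i)))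
      (veroneseRelations (TwoSidedIdeal.span R) d v) where
  finite_generators := inferInstance
  finite_relations := H.finite_veroneseRelations
  quadratic f hf := ((H.mem_span_veroneseRelations_iff f).mp (Submodule.subset_span hf)).2
  iso := by
    refine ⟨H.veroneseEquiv, fun i => H.veroneseEquiv_presentedMk _, fun m => ?_⟩
    ext y
    have h := H.map_substHom_homogeneousPart m
    constructor
    · rintro ⟨_, ⟨f, hf, rfl⟩, rfl⟩
      change substHom R v f ∈ gradedPart R (m * d)
      rw [← h]
      exact ⟨f, hf, rfl⟩
    · intro hy
      change (y : PresentedAlg R) ∈ gradedPart R (m * d) at hy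
      rw [← h] at hy
      obtain ⟨f, hf, hfy⟩ := hy
      exact ⟨_, ⟨f, hf, rfl⟩, Subtype.ext hfy⟩

end IsVeroneseEnumeration

end Presentation

end QuadVeronese

end

open QuadVeronese in
theorem theorem6 {𝕜 X : Type*} [Field 𝕜] [Finite X] [LinearOrder X]
    (R : Set (FreeAlg 𝕜 X)) (hbin : IsQuadraticBinomialSet R) (hred : IsReducedSet R)
    (d : ℕ) (hd : 2 ≤ d)
    -- `v₁ < ⋯ < v_p` is the lexicographic enumeration of `𝒩_d`
    (p : ℕ) (v : Fin p → FreeMonoid X)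
    (hv_lex : ∀ i j : Fin p, i < j → LexLT (v i) (v j))
    (hv_range : Set.range v = normalWordsOfLength (TwoSidedIdeal.span R) d) :
    -- normal forms of non-normal products `v_i v_j` are products `v_{i'} v_{j'}`, uniquely
    (∀ i j : Fin p, v i * v j ∉ normalWordsOfLength (TwoSidedIdeal.span R) (2 * d) →
      ∃! q : Fin p × Fin p, IsNormalForm (TwoSidedIdeal.span R)
        (word 𝕜 (v i * v j)) (word 𝕜 (v q.1 * v q.2))) ∧
    ∃ g : Fin p → veronese (gradedPart R) d,
      (∀ i, (g i : PresentedAlg R) = presentedMk R (word 𝕜 (v i))) ∧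
      -- (1)
      IsQuadraticPresentation (veronesePart (gradedPart R) d) g
        (veroneseRelations (TwoSidedIdeal.span R) d v) ∧
      -- (2)
      LinearIndepOn 𝕜 id (veroneseRelations (TwoSidedIdeal.span R) d v) ∧
      (∀ f : FreeAlg 𝕜 (Fin p),
        f ∈ Submodule.span 𝕜 (veroneseRelations (TwoSidedIdeal.span R) d v) ↔
          f ∈ TwoSidedIdeal.span (veroneseRelations (TwoSidedIdeal.span R) d v) ∧
          f ∈ homogeneousPart 𝕜 (Fin p) 2) ∧
      -- (3)
      (IsGroebnerBasis R (TwoSidedIdeal.span R) →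
        IsPBWGenerators (veronesePart (gradedPart R) d) g ∧
        IsGroebnerBasis (veroneseRelations (TwoSidedIdeal.span R) d v)
          (TwoSidedIdeal.span (veroneseRelations (TwoSidedIdeal.span R) d v))) := by
  have H : IsVeroneseEnumeration R d v :=
    { binomial := fun f hf => by
        obtain ⟨x, y, a, b, -, h⟩ := hbin f hf
        exact ⟨_, _, h, rfl, rfl⟩
      pos := by omega
      lex := hv_lex
      range := hv_range }
  refine ⟨fun i j _ => H.existsUnique_isNormalForm i j,
    fun i => H.veroneseHom (word 𝕜 (FreeMonoid.of i)), fun i => ?_, H.isQuadraticPresentation,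
    H.linearIndepOn_veroneseRelations, H.mem_span_veroneseRelations_iff, fun hG => ?_⟩
  · exact (substHom_word R v _).trans (by rw [substWord_of])
  · exact ⟨⟨_, H.isQuadraticPresentation, H.isGroebnerBasis_veroneseRelations hG⟩,
      H.isGroebnerBasis_veroneseRelations hG⟩
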